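/- **Setting.** Let $\mathcal X\subset\mathbb R^{d_1}$ and $\Omega\subset\mathbb R^{d_2}$ be compact and convex, and let $M\ge 1$. For each $m\in\{1,\dots,M\}$ let $k^{(m)}$ be a (measurable) positive-definite kernel on $\mathcal X\times\Omega$ with $k^{(m)}(z,z)\le 1$ for all $z$, and let $f^{(m)}$ be an element of its reproducing kernel Hilbert space with $\|f^{(m)}\|_{\mathcal H(k^{(m)})}\le B_m<\infty$. At step $i\ge 1$ a point $z_i=(x_i,w_i)\in\mathcal X\times\Omega$ is queried and $y_i^{(m)}=f^{(m)}(z_i)+\varepsilon_i^{(m)}$ is observed for all $m$, where the noises $\varepsilon_i^{(m)}\sim N(0,\varsigma_m^2)$, $\varsigma_m>0$, are independent over $i$ and $m$. The point $z_{t+1}$ may be chosen (measurably) in any way from the information available after $t$ observations, of which the noises $(\varepsilon_{t+1}^{(m)})_m$ are independent. Let $\mu_t^{(m)}$ and $\sigma_t^{(m)2}$ be the posterior mean and variance, after the first $t$ observations, of the Gaussian process with prior mean $0$, covariance $k^{(m)}$ and noise variance $\varsigma_m^2$. For $\delta\in(0,1)$ put $$\kappa_t^{(m)}=\tfrac12\sup_{\tilde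 z_1,\dots,\tilde z_t\in\mathcal X\times\Omega}\log\det\bigl(I_t+\varsigma_m^{-2}(k^{(m)}(\tilde z_i,\tilde z_j))_{i,j\le t}\bigr),\qquad \beta_{m,t}^{1/2}=B_m+\sqrt{2\bigl(\kappa_t^{(m)}+\log(M/\delta)\bigr)} .$$ Let $\rho^{(m)}$ be risk measures, i.e. functionals assigning a real number to a function on $\Omega$, and put $F^{(m)}(x)=\rho^{(m)}(f^{(m)}(x,\cdot))$ and $F=(F^{(1)},\dots,F^{(M)})$. For each $t\ge 0$ let $\mathrm{lcb}_t^{(m)},\mathrm{ucb}_t^{(m)}:\mathcal X\to\mathbb R$ (possibly random) satisfy the credible-interval condition: for all $m$ and $x\in\mathcal X$, $$\mathrm{lcb}_t^{(m)}(x)\le\rho^{(m)}(g)\le\mathrm{ucb}_t^{(m)}(x)$$ for every measurable $g:\Omega\to\mathbb R$ with $|g(w)-\mu_t^{(m)}(x,w)|\le\beta_{m,t+1}^{1/2}\sigma_t^{(m)}(x,w)$ for all $w\in\Omega$. Put $\mathrm{LCB}_t=(\mathrm{lcb}_t^{(m)})_m$ and $\mathrm{UCB}_t=(\mathrm{ucb}_t^{(m)})_m$.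 For $A\subset\mathbb R^M$ let $\mathrm{Dom}(A)=\{s:\exists s'\in A,\ s\le s'\}$ (coordinatewise order) and $\mathrm{Par}(A)=\partial\,\mathrm{Dom}(A)$, and let $\mathrm{dist}(a,A)=\inf_{b\in A}\|a-b\|_\infty$ (with $\inf\emptyset=\infty$). Define $$Z^*=\mathrm{Par}(F(\mathcal X)),\quad \hat\Pi_t=\{x\in\mathcal X:\mathrm{LCB}_t(x)\in\mathrm{Par}(\mathrm{LCB}_t(\mathcal X))\},\quad a_t^{(\mathcal X)}(x)=\mathrm{dist}\bigl(\mathrm{UCB}_t(x),\mathrm{Dom}(\mathrm{LCB}_t(\hat\Pi_t))\bigr),$$ $$I_t=\max\Bigl\{\sup_{y\in Z^*}\mathrm{dist}\bigl(y,\mathrm{Par}(F(\hat\Pi_t))\bigr),\ \sup_{y\in F(\hat\Pi_t)}\mathrm{dist}(y,Z^*)\Bigr\}.$$ **Theorem.** With probability at least $1-\delta$, for every $t\ge 0$ and every maximizer $x_{t+1}$ of $a_t^{(\mathcal X)}$ over $\mathcal X$, $$I_t\le a_t^{(\mathcal X)}(x_{t+1}).$$ Consequently, on the same event, for every $\epsilon>0$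 and every $T\ge 0$: if the stopping condition $a_T^{(\mathcal X)}(x_{T+1})\le\epsilon$ holds at step $T$, where $x_{T+1}$ is a maximizer of $a_T^{(\mathcal X)}$, then $I_T\le\epsilon$. -/

import Mathlib

open MeasureTheory ProbabilityTheory
open scoped ENNReal Matrix

namespace ParetoBO

noncomputable section

/-! ### Pareto fronts, `ℓ^∞` distances and the inference discrepancy

`Fin M → ℝ` carries the sup metric, so `Metric.infEDist` is the `ℓ^∞` distance to a set.  Distances
and suprema of distances are `[0, ∞]`-valued (`inf ∅ = ∞`, `sup ∅ = 0`), so that no default value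
occurs. -/

/-- The dominated region `Dom(B)`. -/
def Dom {M : ℕ} (B : Set (Fin M → ℝ)) : Set (Fin M → ℝ) :=
  {s | ∃ s' ∈ B, ∀ m, s m ≤ s' m}

/-- The Pareto front `Par(B)`, the boundary of the dominated region. -/
def Par {M : ℕ} (B : Set (Fin M → ℝ)) : Set (Fin M → ℝ) :=
  frontier (Dom B)

/-- `dist(a, B) = inf_{b ∈ B} max_m |a_m - b_m|`. -/
def distInf {M : ℕ} (a : Fin M → ℝ) (B : Set (Fin M → ℝ)) : ℝ≥0∞ :=
  Metric.infEDist a B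

/-- The inference discrepancy `max {I⁽ⁱ⁾, I⁽ⁱⁱ⁾}` of a set `E` of design variables, for the vector
`F` of objectives; the true Pareto front is `Par (Set.range F)`. -/
def inferenceDiscrepancy {M : ℕ} {X : Type*} (F : X → Fin M → ℝ) (E : Set X) : ℝ≥0∞ :=
  max (⨆ y ∈ Par (Set.range F), distInf y (Par (F '' E)))
    (⨆ y ∈ F '' E, distInf y (Par (Set.range F)))

/-- The estimated Pareto solution set `{x | LCB(x) ∈ Par(LCB(𝒳))}`. -/
def estimatedSet {M : ℕ} {X : Type*} (LCB : X → Fin M → ℝ) : Set X :=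
  {x | LCB x ∈ Par (Set.range LCB)}

/-- The acquisition function `a(x) = dist(UCB(x), Dom(LCB(estimated set)))`. -/
def acquisition {M : ℕ} {X : Type*} (LCB UCB : X → Fin M → ℝ) (x : X) : ℝ≥0∞ :=
  distInf (UCB x) (Dom (LCB '' estimatedSet LCB))

/-- `x` is a maximizer of the acquisition function, i.e. an admissible choice of the next design
variable. -/
def IsNextDesign {M : ℕ} {X : Type*} (LCB UCB : X → Fin M → ℝ) (x : X) : Prop :=
  ∀ x' : X, acquisition LCB UCB x' ≤ acquisition LCB UCB x

/-! ### Gaussian process posterior and confidence width -/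

/-- `H` is the reproducing kernel Hilbert space of the real-valued kernel `k`. -/
def IsRKHSOf {Z : Type*} (H : Type*) [NormedAddCommGroup H] [InnerProductSpace ℝ H]
    [CompleteSpace H] [RKHS ℝ H Z ℝ] (k : Z → Z → ℝ) : Prop :=
  ∀ z z' : Z, RKHS.kernel H z z' 1 = k z z'

/-- The Gram matrix of `k` at the points `p 0, …, p (t - 1)`. -/
def gram {Z : Type*} (k : Z → Z → ℝ) {t : ℕ} (p : Fin t → Z) : Matrix (Fin t) (Fin t) ℝ :=
  Matrix.of fun i j => k (p i) (p j)

/-- Posterior mean at `z` of the Gaussian process with prior mean `0`, kernel `k` and noise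
variance `s ^ 2`, given observations `y` at the points `p`. -/
def postMean {Z : Type*} (k : Z → Z → ℝ) (s : ℝ) {t : ℕ} (p : Fin t → Z) (y : Fin t → ℝ)
    (z : Z) : ℝ :=
  (fun i => k z (p i)) ⬝ᵥ ((gram k p + s ^ 2 • (1 : Matrix (Fin t) (Fin t) ℝ))⁻¹ *ᵥ y)

/-- Posterior variance at `z`. -/
def postVar {Z : Type*} (k : Z → Z → ℝ) (s : ℝ) {t : ℕ} (p : Fin t → Z) (z : Z) : ℝ :=
  k z z - (fun i => k z (p i)) ⬝ᵥ
    ((gram k p + s ^ 2 • (1 : Matrix (Fin t) (Fin t) ℝ))⁻¹ *ᵥ (fun i => k z (p i)))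

/-- The maximum information gain of `t` points. -/
def maxInfoGain {Z : Type*} (k : Z → Z → ℝ) (s : ℝ) (t : ℕ) : ℝ :=
  (1 / 2) * ⨆ p : Fin t → Z,
    Real.log (((1 : Matrix (Fin t) (Fin t) ℝ) + (s ^ 2)⁻¹ • gram k p).det)

/-- The confidence width `β_t^{1/2} = B + √(2 (κ_t + log (M / δ)))`. -/
def betaSqrt {Z : Type*} (k : Z → Z → ℝ) (s B : ℝ) (M : ℕ) (δ : ℝ) (t : ℕ) : ℝ :=
  B + √(2 * (maxInfoGain k s t + Real.log (M / δ)))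

/-- Lower end of the credible interval of `f(z)` after `t` observations `y` at the points `p`. -/
def lowerCI {Z : Type*} (k : Z → Z → ℝ) (s B : ℝ) (M : ℕ) (δ : ℝ) {t : ℕ} (p : Fin t → Z)
    (y : Fin t → ℝ) (z : Z) : ℝ :=
  postMean k s p y z - betaSqrt k s B M δ (t + 1) * √(postVar k s p z)

/-- Upper end of the credible interval of `f(z)` after `t` observations `y` at the points `p`. -/
def upperCI {Z : Type*} (k : Z → Z → ℝ) (s B : ℝ) (M : ℕ) (δ : ℝ) {t : ℕ} (p : Fin t → Z)
    (y : Fin t → ℝ) (z : Z) : ℝ :=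
  postMean k s p y z + betaSqrt k s B M δ (t + 1) * √(postVar k s p z)

/-- The functions `w ↦ g(x, w)`, measurable in `w`, that lie in the credible interval of `f(x, w)`
for every `w`. -/
def credibleFunctions {X W : Type*} [MeasurableSpace W] (k : X × W → X × W → ℝ) (s B : ℝ) (M : ℕ)
    (δ : ℝ) {t : ℕ} (p : Fin t → X × W) (y : Fin t → ℝ) (x : X) : Set (W → ℝ) :=
  {g | Measurable g ∧
    ∀ w, g w ∈ Set.Icc (lowerCI k s B M δ p y (x, w)) (upperCI k s B M δ p y (x, w))}

end

end ParetoBO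

open ParetoBO

namespace ParetoBO

open scoped RealInnerProductSpace

/-! ### Geometry of dominated regions -/

/-! The argument splits into a deterministic inequality and a time-uniform confidence event.

Deterministic part (`inferenceDiscrepancy_le_of_acquisition_le`): suppose LCB ≤ F ≤ UCB and the
acquisition function is at most `a`. Up to an arbitrarily small slack, every `UCB x` lies below `LCB
e + a` for some estimated `e`. A true Pareto point is never interior to the smaller region dominated
by the estimated set, and lowering it by `a` puts it inside that region. Conversely `F e` is
dominated, and raising it by `a` leaves the interior of the true region, since otherwise `LCB e`
would be interior to the region of LCB. In both cases the segment crosses the relevant front within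
sup-distance `a`.

Probabilistic part: the posterior mean is linear in the observations. Its noiseless part errs by at
most `B` standard deviations (`abs_inner_sub_postMean_le`), its noise part by at most the square
root of the noise energy (`postMean_sq_le`). Half the energy minus half the log-determinant is the
log-likelihood ratio of `N(0, K + s²)` against `N(0, s²)`. Along adaptive queries this ratio is a
nonnegative martingale of mean one, so the maximal inequality bounds by `δ / M` the probability that
it ever reaches `M / δ`. A union bound over the objectives gives the event. -/

lemma exists_mem_frontier_segment {E : Type*} [AddCommGroup E] [Module ℝ E] [TopologicalSpace E]
    [ContinuousAdd E] [ContinuousSMul ℝ E] {D : Set E} {a b : E} (ha : a ∈ D)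
    (hb : b ∉ interior D) : ∃ c ∈ segment ℝ a b, c ∈ frontier D := by
  by_contra! h
  -- A segment missing the frontier would be covered by the disjoint open sets interior and
  -- exterior, with `a` in the first and `b` in the second.
  have hpre : IsPreconnected (segment ℝ a b) := (convex_segment a b).isPreconnected
  have hsub : segment ℝ a b ⊆ interior D ∪ (closure D)ᶜ := by
    intro c hc
    by_cases hcl : c ∈ closure D
    · by_contra hn
      exact h c hc ⟨hcl, fun hi => hn (Or.inl hi)⟩
    · exact Or.inr hcl
  have hai : a ∈ interior D :=
    (hsub (left_mem_segment ℝ a b)).resolve_right fun h' => h' (subset_closure ha)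
  have hbi : b ∈ (closure D)ᶜ := (hsub (right_mem_segment ℝ a b)).resolve_left hb
  obtain ⟨c, -, hc1, hc2⟩ := hpre _ _ isOpen_interior isClosed_closure.isOpen_compl hsub
    ⟨a, left_mem_segment ℝ a b, hai⟩ ⟨b, right_mem_segment ℝ a b, hbi⟩
  exact hc2 (subset_closure (interior_subset hc1))

/-- Sup-norm balls are convex, so the crossing point on the segment stays in the ball that contains
both endpoints. -/
lemma distInf_frontier_le_of_mem {M : ℕ} {D : Set (Fin M → ℝ)} {a b y : Fin M → ℝ} {r : ℝ}
    (ha : a ∈ D) (hb : b ∉ interior D) (hya : dist y a ≤ r) (hyb : dist y b ≤ r) :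
    distInf y (frontier D) ≤ ENNReal.ofReal r := by
  obtain ⟨c, hc, hcD⟩ := exists_mem_frontier_segment ha hb
  refine (Metric.infEDist_le_edist_of_mem hcD).trans ?_
  have : c ∈ Metric.closedBall y r :=
    (convex_closedBall y r).segment_subset (by rwa [Metric.mem_closedBall, dist_comm])
      (by rwa [Metric.mem_closedBall, dist_comm]) hc
  rw [edist_dist, dist_comm]
  exact ENNReal.ofReal_le_ofReal this

lemma dom_mono {M : ℕ} {A B : Set (Fin M → ℝ)} (h : A ⊆ B) : Dom A ⊆ Dom B :=
  fun _ ⟨s', hs', hle⟩ => ⟨s', h hs', hle⟩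

lemma exists_le_add_of_distInf_dom_lt {M : ℕ} {A : Set (Fin M → ℝ)} {u : Fin M → ℝ} {r : ℝ}
    (h : distInf u (Dom A) < ENNReal.ofReal r) : ∃ s ∈ A, ∀ m, u m ≤ s m + r := by
  obtain ⟨d, ⟨s, hs, hds⟩, hd⟩ := Metric.infEDist_lt_iff.mp h
  refine ⟨s, hs, fun m => ?_⟩
  have hr : 0 < r := by
    by_contra! hr
    simp [ENNReal.ofReal_of_nonpos hr] at hd
  rw [edist_dist, ENNReal.ofReal_lt_ofReal_iff hr] at hd
  have h1 := (dist_le_pi_dist u d m).trans hd.le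
  rw [Real.dist_eq] at h1
  linarith [le_abs_self (u m - d m), hds m]

lemma mem_interior_dom_of_add_le {M : ℕ} {A : Set (Fin M → ℝ)} {y s : Fin M → ℝ} {r : ℝ}
    (hr : 0 < r) (hs : s ∈ A) (h : ∀ m, y m + r ≤ s m) : y ∈ interior (Dom A) := by
  rw [mem_interior_iff_mem_nhds, Metric.mem_nhds_iff]
  refine ⟨r, hr, fun d hd => ⟨s, hs, fun m => ?_⟩⟩
  have h1 := (dist_le_pi_dist d y m).trans (Metric.mem_ball.mp hd).le
  rw [Real.dist_eq] at h1
  linarith [le_abs_self (d m - y m), h m]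

lemma dist_self_add_const_le {M : ℕ} (y : Fin M → ℝ) (r : ℝ) :
    dist y (fun m => y m + r) ≤ |r| := by
  rw [dist_pi_le_iff (abs_nonneg r)]
  intro m
  simp

/-- If the objectives lie between the bounds, the inference discrepancy of the estimated Pareto set
is at most any common bound of the acquisition function. -/
theorem inferenceDiscrepancy_le_of_acquisition_le {M : ℕ} {X : Type*} {F L U : X → Fin M → ℝ}
    (hLF : ∀ x m, L x m ≤ F x m) (hFU : ∀ x m, F x m ≤ U x m) {a : ℝ≥0∞}
    (ha : ∀ x, acquisition L U x ≤ a) :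
    inferenceDiscrepancy F (estimatedSet L) ≤ a := by
  rcases eq_or_ne a ⊤ with rfl | hat
  · exact le_top
  -- The slack is spent in halves: one on the unattained infimum in the acquisition function, the
  -- other on approximating a closure point or on leaving room for an open ball.
  refine ENNReal.le_of_forall_pos_le_add fun η hη _ => ?_
  have hη' : (0 : ℝ) < η := hη
  set r : ℝ := a.toReal with hr
  have hr0 : 0 ≤ r := ENNReal.toReal_nonneg
  have har : a = ENNReal.ofReal r := (ENNReal.ofReal_toReal hat).symm
  have hsum : a + η = ENNReal.ofReal (r + η) := by
    rw [ENNReal.ofReal_add hr0 hη'.le, har, ENNReal.ofReal_coe_nnreal]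
  have key : ∀ x, ∃ e ∈ estimatedSet L, ∀ m, U x m ≤ L e m + (r + η / 2) := by
    intro x
    have : distInf (U x) (Dom (L '' estimatedSet L)) < ENNReal.ofReal (r + η / 2) := by
      refine (ha x).trans_lt ?_
      rw [har]
      exact (ENNReal.ofReal_lt_ofReal_iff (by linarith)).2 (by linarith)
    obtain ⟨_, ⟨e, he, rfl⟩, h⟩ := exists_le_add_of_distInf_dom_lt this
    exact ⟨e, he, h⟩
  rw [hsum]
  refine max_le (iSup₂_le fun y hy => ?_) (iSup₂_le fun y hy => ?_)
  · have hyc : y ∈ closure (Dom (Set.range F)) := hy.1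
    have hyi : y ∉ interior (Dom (F '' estimatedSet L)) := fun h =>
      hy.2 (interior_mono (dom_mono (Set.image_subset_range F _)) h)
    obtain ⟨d, ⟨_, ⟨x, rfl⟩, hdx⟩, hyd⟩ := Metric.mem_closure_iff.mp hyc (η / 2) (by linarith)
    obtain ⟨e, he, hxe⟩ := key x
    -- Componentwise, `y - η/2 ≤ F x ≤ U x ≤ L e + r + η/2 ≤ F e + r + η/2`.
    have hmem : (fun m => y m + -(r + η)) ∈ Dom (F '' estimatedSet L) := by
      refine ⟨F e, ⟨e, he, rfl⟩, fun m => ?_⟩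
      have h1 := (dist_le_pi_dist y d m).trans hyd.le
      rw [Real.dist_eq] at h1
      linarith [le_abs_self (y m - d m), hdx m, hFU x m, hxe m, hLF e m]
    refine distInf_frontier_le_of_mem hmem hyi ?_ (by rw [dist_self]; linarith)
    refine (dist_self_add_const_le y _).trans ?_
    rw [abs_neg, abs_of_nonneg (by linarith)]
  · obtain ⟨e, he, rfl⟩ := hy
    -- If the raised point were dominated by `F x`, then `L e + η/2 ≤ L e'` for some `e'`, so `L e`
    -- would be interior to the dominated region, not on its front.
    have hnot : (fun m => F e m + (r + η)) ∉ interior (Dom (Set.range F)) := by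
      intro h
      obtain ⟨_, ⟨x, rfl⟩, hx⟩ := interior_subset h
      obtain ⟨e', -, hxe⟩ := key x
      refine he.2 (mem_interior_dom_of_add_le (r := η / 2) (by linarith) ⟨e', rfl⟩ fun m => ?_)
      have hxm : F e m + (r + η) ≤ F x m := hx m
      linarith [hFU x m, hxe m, hLF e m]
    refine distInf_frontier_le_of_mem (a := F e) ⟨F e, ⟨e, rfl⟩, fun m => le_rfl⟩ hnot
      (by rw [dist_self]; linarith) ?_
    refine (dist_self_add_const_le _ _).trans ?_
    rw [abs_of_nonneg (by linarith)]

/-! ### Gaussian process regression with a feature map -/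

lemma postMean_def {Z : Type*} (k : Z → Z → ℝ) (s : ℝ) {t : ℕ} (p : Fin t → Z) (y : Fin t → ℝ)
    (z : Z) : postMean k s p y z =
      (fun i => k z (p i)) ⬝ᵥ ((gram k p + s ^ 2 • (1 : Matrix (Fin t) (Fin t) ℝ))⁻¹ *ᵥ y) :=
  rfl

lemma postVar_def {Z : Type*} (k : Z → Z → ℝ) (s : ℝ) {t : ℕ} (p : Fin t → Z) (z : Z) :
    postVar k s p z = k z z - (fun i => k z (p i)) ⬝ᵥ
      ((gram k p + s ^ 2 • (1 : Matrix (Fin t) (Fin t) ℝ))⁻¹ *ᵥ (fun i => k z (p i))) :=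
  rfl

section Feature

variable {Z E : Type*} [NormedAddCommGroup E] [InnerProductSpace ℝ E] {φ : Z → E}
  {k : Z → Z → ℝ}

lemma posDef_gram_add (hk : ∀ z z', k z z' = ⟪φ z, φ z'⟫) {s : ℝ} (hs : 0 < s) {t : ℕ}
    (p : Fin t → Z) : (gram k p + s ^ 2 • (1 : Matrix (Fin t) (Fin t) ℝ)).PosDef := by
  have h : gram k p = Matrix.gram ℝ (fun i => φ (p i)) := by
    ext i j
    simp [gram, Matrix.gram_apply, hk]
  rw [h]
  exact Matrix.PosDef.posSemidef_add (Matrix.posSemidef_gram ℝ _)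
    (Matrix.PosDef.one.smul (by positivity))

lemma gram_add_mulVec_inv_mulVec (hk : ∀ z z', k z z' = ⟪φ z, φ z'⟫) {s : ℝ} (hs : 0 < s) {t : ℕ}
    (p : Fin t → Z) (y : Fin t → ℝ) :
    (gram k p + s ^ 2 • (1 : Matrix (Fin t) (Fin t) ℝ)) *ᵥ
      ((gram k p + s ^ 2 • (1 : Matrix (Fin t) (Fin t) ℝ))⁻¹ *ᵥ y) = y := by
  rw [Matrix.mulVec_mulVec, Matrix.mul_nonsing_inv _ (posDef_gram_add hk hs p).det_pos.ne'.isUnit,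
    Matrix.one_mulVec]

lemma dotProduct_inv_gram_add_mulVec_comm (hk : ∀ z z', k z z' = ⟪φ z, φ z'⟫) {s : ℝ} (hs : 0 < s)
    {t : ℕ} (p : Fin t → Z) (a b : Fin t → ℝ) :
    a ⬝ᵥ ((gram k p + s ^ 2 • (1 : Matrix (Fin t) (Fin t) ℝ))⁻¹ *ᵥ b) =
      ((gram k p + s ^ 2 • (1 : Matrix (Fin t) (Fin t) ℝ))⁻¹ *ᵥ a) ⬝ᵥ b := by
  have h := (posDef_gram_add hk hs p).inv.isHermitian.eq
  rw [Matrix.conjTranspose_eq_transpose_of_trivial] at h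
  rw [Matrix.dotProduct_mulVec, ← Matrix.mulVec_transpose, h]

lemma inner_sum_smul_right (hk : ∀ z z', k z z' = ⟪φ z, φ z'⟫) {t : ℕ} (p : Fin t → Z)
    (a : Fin t → ℝ) (z : Z) : ⟪φ z, ∑ i, a i • φ (p i)⟫ = (fun i => k z (p i)) ⬝ᵥ a := by
  simp [inner_sum, inner_smul_right, dotProduct, hk, mul_comm]

lemma inner_sum_smul_sum_smul (hk : ∀ z z', k z z' = ⟪φ z, φ z'⟫) {t : ℕ} (p : Fin t → Z)
    (a b : Fin t → ℝ) :
    ⟪∑ i, a i • φ (p i), ∑ i, b i • φ (p i)⟫ = a ⬝ᵥ (gram k p *ᵥ b) := by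
  rw [sum_inner]
  simp_rw [inner_smul_left, inner_sum_smul_right hk]
  rfl

/-- The posterior variance is the squared norm of `(φ z - ∑ αᵢ φ(pᵢ), s α)` in `E ⊕ ℝᵗ`; expand the
square and use `(K + s²) α = k_z`. -/
lemma norm_sq_residual_add (hk : ∀ z z', k z z' = ⟪φ z, φ z'⟫) {s : ℝ} (hs : 0 < s) {t : ℕ}
    (p : Fin t → Z) (z : Z) {α : Fin t → ℝ}
    (hα : α = (gram k p + s ^ 2 • (1 : Matrix (Fin t) (Fin t) ℝ))⁻¹ *ᵥ fun i => k z (p i)) :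
    ‖φ z - ∑ i, α i • φ (p i)‖ ^ 2 + s ^ 2 * (α ⬝ᵥ α) = postVar k s p z := by
  have h1 := gram_add_mulVec_inv_mulVec hk hs p (fun i => k z (p i))
  rw [← hα, Matrix.add_mulVec, Matrix.smul_mulVec, Matrix.one_mulVec] at h1
  have h2 := congrArg (fun v => α ⬝ᵥ v) h1
  simp only [dotProduct_add, dotProduct_smul, smul_eq_mul] at h2
  rw [norm_sub_sq_real, ← real_inner_self_eq_norm_sq, ← real_inner_self_eq_norm_sq,
    inner_sum_smul_right hk, inner_sum_smul_sum_smul hk, ← hk, postVar, ← hα]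
  have h3 := dotProduct_comm α (fun i => k z (p i))
  linarith

lemma postVar_nonneg (hk : ∀ z z', k z z' = ⟪φ z, φ z'⟫) {s : ℝ} (hs : 0 < s) {t : ℕ}
    (p : Fin t → Z) (z : Z) : 0 ≤ postVar k s p z := by
  rw [← norm_sq_residual_add hk hs p z rfl]
  have : 0 ≤ ((gram k p + s ^ 2 • (1 : Matrix (Fin t) (Fin t) ℝ))⁻¹ *ᵥ fun i => k z (p i)) ⬝ᵥ
      ((gram k p + s ^ 2 • (1 : Matrix (Fin t) (Fin t) ℝ))⁻¹ *ᵥ fun i => k z (p i)) :=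
    Finset.sum_nonneg fun i _ => mul_self_nonneg _
  positivity

lemma postMean_add (k : Z → Z → ℝ) (s : ℝ) {t : ℕ} (p : Fin t → Z) (y e : Fin t → ℝ) (z : Z) :
    postMean k s p (fun i => y i + e i) z = postMean k s p y z + postMean k s p e z := by
  have : (fun i => y i + e i) = y + e := rfl
  rw [this, postMean, Matrix.mulVec_add, dotProduct_add]
  rfl

/-- The posterior mean of noiseless observations of `g` misses `g` by at most `‖g‖` posterior
standard deviations. -/
lemma abs_inner_sub_postMean_le (hk : ∀ z z', k z z' = ⟪φ z, φ z'⟫) {s : ℝ} (hs : 0 < s) {t : ℕ}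
    (p : Fin t → Z) (g : E) (z : Z) :
    |⟪φ z, g⟫ - postMean k s p (fun i => ⟪φ (p i), g⟫) z| ≤ ‖g‖ * √(postVar k s p z) := by
  obtain ⟨α, hα⟩ : ∃ α, α =
    (gram k p + s ^ 2 • (1 : Matrix (Fin t) (Fin t) ℝ))⁻¹ *ᵥ fun i => k z (p i) := ⟨_, rfl⟩
  have h1 := norm_sq_residual_add hk hs p z hα
  have h2 : ⟪φ z, g⟫ - postMean k s p (fun i => ⟪φ (p i), g⟫) z =
      ⟪φ z - ∑ i, α i • φ (p i), g⟫ := by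
    rw [postMean, dotProduct_inv_gram_add_mulVec_comm hk hs, ← hα, inner_sub_left, sum_inner]
    simp [inner_smul_left, dotProduct]
  have h3 : 0 ≤ α ⬝ᵥ α := Finset.sum_nonneg fun i _ => mul_self_nonneg _
  rw [h2, mul_comm]
  refine (abs_real_inner_le_norm _ _).trans (mul_le_mul_of_nonneg_right ?_ (norm_nonneg _))
  refine Real.le_sqrt_of_sq_le ?_
  rw [← h1]
  have : 0 ≤ s ^ 2 * (α ⬝ᵥ α) := by positivity
  linarith

/-- The self-normalised energy `s⁻² eᵀ K (K + s²)⁻¹ e` of the noise vector `e`. -/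
noncomputable def noiseEnergy (k : Z → Z → ℝ) (s : ℝ) {t : ℕ} (p : Fin t → Z) (e : Fin t → ℝ) : ℝ :=
  (s ^ 2)⁻¹ * (e ⬝ᵥ e) -
    e ⬝ᵥ ((gram k p + s ^ 2 • (1 : Matrix (Fin t) (Fin t) ℝ))⁻¹ *ᵥ e)

/-- With `u = (K + s²)⁻¹ e`, this is Cauchy–Schwarz in `E ⊕ ℝᵗ` for `(φ z - ∑ αᵢ φ(pᵢ), s α)` and
`(∑ uᵢ φ(pᵢ), s⁻¹ K u)`, whose squared norms are the posterior variance and the noise energy. -/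
lemma postMean_sq_le (hk : ∀ z z', k z z' = ⟪φ z, φ z'⟫) {s : ℝ} (hs : 0 < s) {t : ℕ}
    (p : Fin t → Z) (e : Fin t → ℝ) (z : Z) :
    postMean k s p e z ^ 2 ≤ postVar k s p z * noiseEnergy k s p e := by
  obtain ⟨α, hα⟩ : ∃ α, α =
    (gram k p + s ^ 2 • (1 : Matrix (Fin t) (Fin t) ℝ))⁻¹ *ᵥ fun i => k z (p i) := ⟨_, rfl⟩
  obtain ⟨u, hu⟩ : ∃ u, u =
    (gram k p + s ^ 2 • (1 : Matrix (Fin t) (Fin t) ℝ))⁻¹ *ᵥ e := ⟨_, rfl⟩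
  have hRu := gram_add_mulVec_inv_mulVec hk hs p e
  rw [← hu, Matrix.add_mulVec, Matrix.smul_mulVec, Matrix.one_mulVec] at hRu
  obtain ⟨w, hw⟩ : ∃ w, w = gram k p *ᵥ u := ⟨_, rfl⟩
  rw [← hw] at hRu
  have hs2 : s ^ 2 ≠ 0 := by positivity
  have hmean : postMean k s p e z =
      ⟪φ z - ∑ i, α i • φ (p i), ∑ i, u i • φ (p i)⟫ + α ⬝ᵥ w := by
    rw [inner_sub_left, inner_sum_smul_right hk, inner_sum_smul_sum_smul hk, ← hw, postMean, ← hu]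
    ring
  have henergy : noiseEnergy k s p e =
      ‖∑ i, u i • φ (p i)‖ ^ 2 + (s ^ 2)⁻¹ * (w ⬝ᵥ w) := by
    rw [noiseEnergy, ← hu, ← real_inner_self_eq_norm_sq, inner_sum_smul_sum_smul hk, ← hw, ← hRu]
    simp only [dotProduct_add, add_dotProduct, dotProduct_smul, smul_dotProduct, smul_eq_mul]
    rw [dotProduct_comm w u]
    field_simp
    ring
  have hcs : (α ⬝ᵥ w) ^ 2 ≤ (α ⬝ᵥ α) * (w ⬝ᵥ w) := by
    have := Finset.sum_mul_sq_le_sq_mul_sq Finset.univ α w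
    simpa [dotProduct, sq] using this
  rw [hmean, henergy, ← norm_sq_residual_add hk hs p z hα]
  have hin := abs_real_inner_le_norm (φ z - ∑ i, α i • φ (p i)) (∑ i, u i • φ (p i))
  obtain ⟨a, ha⟩ : ∃ a, a = ⟪φ z - ∑ i, α i • φ (p i), ∑ i, u i • φ (p i)⟫ := ⟨_, rfl⟩
  have hA := norm_nonneg (φ z - ∑ i, α i • φ (p i))
  have hB := norm_nonneg (∑ i, u i • φ (p i))
  have h3 : 0 ≤ α ⬝ᵥ α := Finset.sum_nonneg fun i _ => mul_self_nonneg _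
  have h4 : 0 ≤ w ⬝ᵥ w := Finset.sum_nonneg fun i _ => mul_self_nonneg _
  rw [← ha] at hin ⊢
  generalize ‖φ z - ∑ i, α i • φ (p i)‖ = A at *
  generalize ‖∑ i, u i • φ (p i)‖ = C at *
  have hb : |α ⬝ᵥ w| ≤ (s * √(α ⬝ᵥ α)) * (s⁻¹ * √(w ⬝ᵥ w)) := by
    have : (s * √(α ⬝ᵥ α)) * (s⁻¹ * √(w ⬝ᵥ w)) = √((α ⬝ᵥ α) * (w ⬝ᵥ w)) := by
      rw [Real.sqrt_mul h3]
      field_simp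
    rw [this]
    exact Real.abs_le_sqrt hcs
  have hD : s ^ 2 * (α ⬝ᵥ α) = (s * √(α ⬝ᵥ α)) ^ 2 := by rw [mul_pow, Real.sq_sqrt h3]
  have hG : (s ^ 2)⁻¹ * (w ⬝ᵥ w) = (s⁻¹ * √(w ⬝ᵥ w)) ^ 2 := by
    rw [mul_pow, Real.sq_sqrt h4, inv_pow]
  rw [hD, hG]
  generalize s * √(α ⬝ᵥ α) = D at *
  generalize s⁻¹ * √(w ⬝ᵥ w) = G at *
  have habs : |a + α ⬝ᵥ w| ≤ A * C + D * G := (abs_add_le _ _).trans (add_le_add hin hb)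
  calc (a + α ⬝ᵥ w) ^ 2 = |a + α ⬝ᵥ w| ^ 2 := (sq_abs _).symm
    _ ≤ (A * C + D * G) ^ 2 := pow_le_pow_left₀ (abs_nonneg _) habs 2
    _ ≤ (A ^ 2 + D ^ 2) * (C ^ 2 + G ^ 2) := by nlinarith [sq_nonneg (A * G - C * D)]

/-! ### Adding one observation -/

lemma inv_gram_add_mulVec_succ (hk : ∀ z z', k z z' = ⟪φ z, φ z'⟫) {s : ℝ} (hs : 0 < s)
    (p : ℕ → Z) (e : ℕ → ℝ) (t : ℕ) :
    (gram k (fun i : Fin (t + 1) => p i) + s ^ 2 • (1 : Matrix (Fin (t + 1)) (Fin (t + 1)) ℝ))⁻¹ *ᵥ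
        (fun i : Fin (t + 1) => e i) =
      Fin.snoc (α := fun _ => ℝ)
        ((gram k (fun i : Fin t => p i) + s ^ 2 • (1 : Matrix (Fin t) (Fin t) ℝ))⁻¹ *ᵥ
            (fun i : Fin t => e i) -
          ((e t - postMean k s (fun i : Fin t => p i) (fun i : Fin t => e i) (p t)) /
              (postVar k s (fun i : Fin t => p i) (p t) + s ^ 2)) •
            ((gram k (fun i : Fin t => p i) + s ^ 2 • (1 : Matrix (Fin t) (Fin t) ℝ))⁻¹ *ᵥ
              (fun i : Fin t => k (p t) (p i))))
        ((e t - postMean k s (fun i : Fin t => p i) (fun i : Fin t => e i) (p t)) /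
          (postVar k s (fun i : Fin t => p i) (p t) + s ^ 2)) := by
  have hv := postVar_nonneg hk hs (fun i : Fin t => p i) (p t)
  have hRu := gram_add_mulVec_inv_mulVec hk hs (fun i : Fin t => p i) (fun i : Fin t => e i)
  have hRα := gram_add_mulVec_inv_mulVec hk hs (fun i : Fin t => p i)
    (fun i : Fin t => k (p t) (p i))
  have hvdef := postVar_def k s (fun i : Fin t => p i) (p t)
  have hmdef := postMean_def k s (fun i : Fin t => p i) (fun i : Fin t => e i) (p t)
  generalize hu : (gram k (fun i : Fin t => p i) + s ^ 2 • (1 : Matrix (Fin t) (Fin t) ℝ))⁻¹ *ᵥ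
            (fun i : Fin t => e i) = u at *
  generalize hα : (gram k (fun i : Fin t => p i) + s ^ 2 • (1 : Matrix (Fin t) (Fin t) ℝ))⁻¹ *ᵥ
            (fun i : Fin t => k (p t) (p i)) = α at *
  generalize postVar k s (fun i : Fin t => p i) (p t) = v at *
  generalize postMean k s (fun i : Fin t => p i) (fun i : Fin t => e i) (p t) = μ at *
  have hvs : v + s ^ 2 ≠ 0 := by positivity
  obtain ⟨c, hc⟩ : ∃ c, c = (e t - μ) / (v + s ^ 2) := ⟨_, rfl⟩
  rw [← hc]
  have hcv : c * (v + s ^ 2) = e t - μ := by rw [hc]; field_simp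
  have hR := posDef_gram_add hk hs (fun i : Fin (t + 1) => p i)
  -- The bordered matrix is invertible, so it is enough that the candidate solves the system: the
  -- old rows follow from the two old systems, the last row from the formulas for mean and variance.
  suffices h : (gram k (fun i : Fin (t + 1) => p i) +
      s ^ 2 • (1 : Matrix (Fin (t + 1)) (Fin (t + 1)) ℝ)) *ᵥ
      (Fin.snoc (α := fun _ => ℝ) (u - c • α) c) = (fun i : Fin (t + 1) => e i) by
    rw [← h, Matrix.mulVec_mulVec, Matrix.nonsing_inv_mul _ hR.det_pos.ne'.isUnit,
      Matrix.one_mulVec]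
  rw [Matrix.add_mulVec, Matrix.smul_mulVec, Matrix.one_mulVec] at hRu hRα ⊢
  ext i
  refine Fin.lastCases ?_ (fun i => ?_) i
  · simp only [Pi.add_apply, Pi.smul_apply, Fin.snoc_last, Matrix.mulVec, dotProduct,
      Fin.sum_univ_castSucc, Fin.snoc_castSucc, gram, Matrix.of_apply, Fin.val_last,
      Fin.val_castSucc, smul_eq_mul, Pi.sub_apply, mul_sub, Finset.sum_sub_distrib]
    simp only [dotProduct] at hvdef hmdef
    have : ∑ x : Fin t, k (p t) (p x) * (c * α x) = c * ∑ x : Fin t, k (p t) (p x) * α x := by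
      rw [Finset.mul_sum]
      exact Finset.sum_congr rfl fun _ _ => by ring
    rw [this, ← hmdef]
    linear_combination hcv - c * hvdef
  · have h1 := congrFun hRu i
    have h2 := congrFun hRα i
    simp only [Pi.add_apply, Pi.smul_apply, Fin.snoc_last, Matrix.mulVec, dotProduct,
      Fin.sum_univ_castSucc, Fin.snoc_castSucc, gram, Matrix.of_apply, Fin.val_last,
      Fin.val_castSucc, smul_eq_mul, Pi.sub_apply, mul_sub, Finset.sum_sub_distrib] at h1 h2 ⊢
    have : ∑ x : Fin t, k (p i) (p x) * (c * α x) = c * ∑ x : Fin t, k (p i) (p x) * α x := by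
      rw [Finset.mul_sum]
      exact Finset.sum_congr rfl fun _ _ => by ring
    have hsymm : k (p i) (p t) = k (p t) (p i) := by rw [hk, hk, real_inner_comm]
    rw [this, hsymm]
    linear_combination h1 - c * h2

/-- The increment is twice the exponent in the density ratio of the predictive law `N(μ, v + s²)`
against `N(0, s²)`. -/
lemma noiseEnergy_succ (hk : ∀ z z', k z z' = ⟪φ z, φ z'⟫) {s : ℝ} (hs : 0 < s)
    (p : ℕ → Z) (e : ℕ → ℝ) (t : ℕ) :
    noiseEnergy k s (fun i : Fin (t + 1) => p i) (fun i => e i) =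
      noiseEnergy k s (fun i : Fin t => p i) (fun i => e i) + (s ^ 2)⁻¹ * e t ^ 2 -
        (e t - postMean k s (fun i : Fin t => p i) (fun i => e i) (p t)) ^ 2 /
          (postVar k s (fun i : Fin t => p i) (p t) + s ^ 2) := by
  have hcomm := dotProduct_inv_gram_add_mulVec_comm hk hs (fun i : Fin t => p i)
    (fun i : Fin t => e i) (fun i => k (p t) (p i))
  rw [dotProduct_comm _ (fun i : Fin t => k (p t) (p i))] at hcomm
  rw [noiseEnergy, inv_gram_add_mulVec_succ hk hs]
  have hmdef := postMean_def k s (fun i : Fin t => p i) (fun i : Fin t => e i) (p t)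
  rw [← hcomm] at hmdef
  rw [noiseEnergy]
  generalize (gram k (fun i : Fin t => p i) + s ^ 2 • (1 : Matrix (Fin t) (Fin t) ℝ))⁻¹ *ᵥ
            (fun i : Fin t => e i) = u at *
  generalize (gram k (fun i : Fin t => p i) + s ^ 2 • (1 : Matrix (Fin t) (Fin t) ℝ))⁻¹ *ᵥ
            (fun i : Fin t => k (p t) (p i)) = α at *
  generalize postMean k s (fun i : Fin t => p i) (fun i : Fin t => e i) (p t) = μ at *
  generalize postVar k s (fun i : Fin t => p i) (p t) = v at *
  have h1 (a : Fin t → ℝ) (b : ℝ) : (fun i : Fin (t + 1) => e i) ⬝ᵥ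
      (Fin.snoc (α := fun _ => ℝ) a b) = (fun i : Fin t => e i) ⬝ᵥ a + e t * b := by
    simp [dotProduct, Fin.sum_univ_castSucc]
  have h2 : (fun i : Fin (t + 1) => e i) ⬝ᵥ (fun i : Fin (t + 1) => e i) =
      (fun i : Fin t => e i) ⬝ᵥ (fun i : Fin t => e i) + e t * e t := by
    simp [dotProduct, Fin.sum_univ_castSucc]
  rw [h1, h2, dotProduct_sub, dotProduct_smul, ← hmdef, smul_eq_mul]
  ring

/-- The Schur complement of the old block is the predictive variance `v + s²`. -/
lemma det_gram_add_succ (hk : ∀ z z', k z z' = ⟪φ z, φ z'⟫) {s : ℝ} (hs : 0 < s)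
    (p : ℕ → Z) (t : ℕ) :
    (gram k (fun i : Fin (t + 1) => p i) + s ^ 2 • (1 : Matrix _ _ ℝ)).det =
      (gram k (fun i : Fin t => p i) + s ^ 2 • (1 : Matrix _ _ ℝ)).det *
        (postVar k s (fun i : Fin t => p i) (p t) + s ^ 2) := by
  have hpos := posDef_gram_add hk hs (fun i : Fin t => p i)
  let _ := Matrix.invertibleOfIsUnitDet _ hpos.det_pos.ne'.isUnit
  have hblock : (gram k (fun i : Fin (t + 1) => p i) + s ^ 2 • (1 : Matrix _ _ ℝ)).submatrix
      (finSumFinEquiv (m := t) (n := 1)) finSumFinEquiv =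
      Matrix.fromBlocks (gram k (fun i : Fin t => p i) + s ^ 2 • (1 : Matrix _ _ ℝ))
        (Matrix.of fun (i : Fin t) (_ : Fin 1) => k (p i) (p t))
        (Matrix.of fun _ (j : Fin t) => k (p t) (p j))
        (Matrix.of fun _ _ => k (p t) (p t) + s ^ 2) := by
    ext i j
    rcases i with i | i <;> rcases j with j | j
    · simp [gram, Matrix.one_apply]
    · have : (Fin.castAdd 1 i) ≠ Fin.natAdd t j := by
        intro h
        have := congrArg Fin.val h
        simp at this
        omega
      simp [gram, this]
    · have : Fin.natAdd t i ≠ (Fin.castAdd 1 j) := by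
        intro h
        have := congrArg Fin.val h
        simp at this
        omega
      simp [gram, this]
    · obtain rfl := Subsingleton.elim i j
      simp [gram]
  rw [← Matrix.det_submatrix_equiv_self (finSumFinEquiv (m := t) (n := 1)), hblock,
    Matrix.det_fromBlocks₁₁,
    Matrix.invOf_eq_nonsing_inv]
  congr 1
  have hsymm : (fun i : Fin t => k (p i) (p t)) = fun i : Fin t => k (p t) (p i) := by
    ext i
    rw [hk, hk, real_inner_comm]
  have hmul (R : Matrix (Fin t) (Fin t) ℝ) :
      ((Matrix.of fun (_ : Fin 1) (j : Fin t) => k (p t) (p j)) *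
        (R * Matrix.of fun (i : Fin t) (_ : Fin 1) => k (p i) (p t))) 0 0 =
      (fun j : Fin t => k (p t) (p j)) ⬝ᵥ (R *ᵥ fun i : Fin t => k (p i) (p t)) := rfl
  rw [Matrix.det_fin_one, Matrix.sub_apply, Matrix.mul_assoc, Matrix.of_apply, postVar_def, hmul,
    hsymm]
  ring

/-! ### Determinants and the information gain -/

lemma det_one_add_gram {s : ℝ} (hs : 0 < s) (k : Z → Z → ℝ) {t : ℕ} (p : Fin t → Z) :
    ((1 : Matrix (Fin t) (Fin t) ℝ) + (s ^ 2)⁻¹ • gram k p).det =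
      ((s ^ 2)⁻¹) ^ t * (gram k p + s ^ 2 • (1 : Matrix (Fin t) (Fin t) ℝ)).det := by
  have hs2 : s ^ 2 ≠ 0 := by positivity
  have : (1 : Matrix (Fin t) (Fin t) ℝ) + (s ^ 2)⁻¹ • gram k p =
      (s ^ 2)⁻¹ • (gram k p + s ^ 2 • (1 : Matrix (Fin t) (Fin t) ℝ)) := by
    rw [smul_add, smul_smul, inv_mul_cancel₀ hs2, one_smul, add_comm]
  rw [this, Matrix.det_smul, Fintype.card_fin]

lemma det_one_add_gram_pos (hk : ∀ z z', k z z' = ⟪φ z, φ z'⟫) {s : ℝ} (hs : 0 < s) {t : ℕ}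
    (p : Fin t → Z) : 0 < ((1 : Matrix (Fin t) (Fin t) ℝ) + (s ^ 2)⁻¹ • gram k p).det := by
  rw [det_one_add_gram hs]
  have := (posDef_gram_add hk hs p).det_pos
  positivity

lemma det_one_add_gram_succ (hk : ∀ z z', k z z' = ⟪φ z, φ z'⟫) {s : ℝ} (hs : 0 < s)
    (p : ℕ → Z) (t : ℕ) :
    (1 + (s ^ 2)⁻¹ • gram k (fun i : Fin (t + 1) => p i)).det =
      (1 + (s ^ 2)⁻¹ • gram k (fun i : Fin t => p i)).det *
        (1 + (s ^ 2)⁻¹ * postVar k s (fun i : Fin t => p i) (p t)) := by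
  have hs2 : s ^ 2 ≠ 0 := by positivity
  rw [det_one_add_gram hs, det_one_add_gram hs, det_gram_add_succ hk hs, pow_succ]
  field_simp
  ring

/-- Ensures that the real supremum in `maxInfoGain` is a genuine one and not the default value. The
entries are at most `1 + s⁻²` in absolute value, so the Leibniz formula bounds the determinant. -/
lemma bddAbove_range_log_det (hk : ∀ z z', k z z' = ⟪φ z, φ z'⟫) (hk1 : ∀ z, k z z ≤ 1) (s : ℝ)
    (t : ℕ) : BddAbove (Set.range fun p : Fin t → Z =>
      Real.log (((1 : Matrix (Fin t) (Fin t) ℝ) + (s ^ 2)⁻¹ • gram k p).det)) := by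
  refine ⟨(Nat.factorial t) • (1 + (s ^ 2)⁻¹) ^ t, ?_⟩
  rintro _ ⟨p, rfl⟩
  dsimp only
  rw [← Real.log_abs]
  refine (Real.log_le_self (abs_nonneg _)).trans ?_
  have hk_abs (z z' : Z) : |k z z'| ≤ 1 := by
    have hn (z : Z) : ‖φ z‖ ≤ 1 := by
      have := hk1 z
      rw [hk, real_inner_self_eq_norm_sq] at this
      exact (sq_le_one_iff₀ (norm_nonneg _)).mp this
    rw [hk]
    exact (abs_real_inner_le_norm _ _).trans (mul_le_one₀ (hn z) (norm_nonneg _) (hn z'))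
  have h := Matrix.det_le (A := (1 : Matrix (Fin t) (Fin t) ℝ) + (s ^ 2)⁻¹ • gram k p)
    (abv := AbsoluteValue.abs) (x := 1 + (s ^ 2)⁻¹) ?_
  · simpa using h
  · intro i j
    have h1 : |(1 : Matrix (Fin t) (Fin t) ℝ) i j| ≤ 1 := by
      rw [Matrix.one_apply]
      split_ifs <;> simp
    have h2 : |(s ^ 2)⁻¹ * k (p i) (p j)| ≤ (s ^ 2)⁻¹ := by
      rw [abs_mul, abs_of_nonneg (by positivity)]
      exact mul_le_of_le_one_right (by positivity) (hk_abs _ _)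
    exact (abs_add_le _ _).trans (add_le_add h1 h2)

/-- The width after `t` observations uses `κ` at `t + 1`. An extra point multiplies the determinant
by `1 + v / s² ≥ 1`, so the index shift is harmless. -/
lemma half_log_det_le_maxInfoGain_succ (hk : ∀ z z', k z z' = ⟪φ z, φ z'⟫) (hk1 : ∀ z, k z z ≤ 1)
    {s : ℝ} (hs : 0 < s) (p : ℕ → Z) (t : ℕ) :
    1 / 2 * Real.log ((1 + (s ^ 2)⁻¹ • gram k (fun i : Fin t => p i)).det) ≤
      maxInfoGain k s (t + 1) := by
  refine mul_le_mul_of_nonneg_left ?_ (by norm_num)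
  refine le_trans ?_ (le_ciSup (bddAbove_range_log_det hk hk1 s (t + 1)) fun i => p i)
  have hpos := det_one_add_gram_pos hk hs (fun i : Fin t => p i)
  refine Real.log_le_log hpos ?_
  rw [det_one_add_gram_succ hk hs]
  have hv := postVar_nonneg hk hs (fun i : Fin t => p i) (p t)
  have : 0 ≤ (s ^ 2)⁻¹ * postVar k s (fun i : Fin t => p i) (p t) := by positivity
  nlinarith

end Feature

/-! ### Measurability -/

/-- The likelihood ratio of the noise vector `e` under the law `N(0, K + s²)` and the law
`N(0, s²)`. -/
noncomputable def evidenceRatio {Z : Type*} (k : Z → Z → ℝ) (s : ℝ) {t : ℕ} (p : Fin t → Z)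
    (e : Fin t → ℝ) : ℝ :=
  Real.exp (1 / 2 * noiseEnergy k s p e -
    1 / 2 * Real.log (((1 : Matrix (Fin t) (Fin t) ℝ) + (s ^ 2)⁻¹ • gram k p).det))

lemma evidenceRatio_nonneg {Z : Type*} (k : Z → Z → ℝ) (s : ℝ) {t : ℕ} (p : Fin t → Z)
    (e : Fin t → ℝ) : 0 ≤ evidenceRatio k s p e :=
  (Real.exp_pos _).le

section Measurability

variable {S : Type*} {mS : MeasurableSpace S}

lemma measurable_det_of_entries {n : Type*} [Fintype n] [DecidableEq n] {A : S → Matrix n n ℝ}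
    (hA : ∀ i j, Measurable fun ω => A ω i j) : Measurable fun ω => (A ω).det := by
  simp_rw [Matrix.det_apply]
  exact Finset.measurable_sum _ fun σ _ =>
    (Finset.measurable_prod _ fun i _ => hA (σ i) i).const_smul _

lemma measurable_inv_apply_of_entries {n : Type*} [Fintype n] [DecidableEq n]
    {A : S → Matrix n n ℝ} (hA : ∀ i j, Measurable fun ω => A ω i j) (i j : n) :
    Measurable fun ω => (A ω)⁻¹ i j := by
  simp_rw [Matrix.inv_def, Matrix.smul_apply, Ring.inverse_eq_inv', Matrix.adjugate_apply]
  refine (measurable_det_of_entries hA).inv.smul (measurable_det_of_entries fun i' j' => ?_)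
  simp_rw [Matrix.updateRow_apply]
  split_ifs
  · exact measurable_const
  · exact hA _ _

variable {Z : Type*} [MeasurableSpace Z] {k : Z → Z → ℝ}

lemma measurable_dotProduct_inv_gram_add_mulVec (hk : Measurable (Function.uncurry k)) (s : ℝ)
    {t : ℕ} {p : S → Fin t → Z} (hp : ∀ i, Measurable fun ω => p ω i) {a b : S → Fin t → ℝ}
    (ha : ∀ i, Measurable fun ω => a ω i) (hb : ∀ i, Measurable fun ω => b ω i) :
    Measurable fun ω => a ω ⬝ᵥ
      ((gram k (p ω) + s ^ 2 • (1 : Matrix (Fin t) (Fin t) ℝ))⁻¹ *ᵥ b ω) := by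
  simp only [dotProduct, Matrix.mulVec]
  refine Finset.measurable_sum _ fun i _ => (ha i).mul (Finset.measurable_sum _ fun j _ =>
    (measurable_inv_apply_of_entries (fun i j => ?_) i j).mul (hb j))
  exact (hk.comp ((hp i).prodMk (hp j))).add_const _

lemma measurable_postMean (hk : Measurable (Function.uncurry k)) (s : ℝ) {t : ℕ}
    {p : S → Fin t → Z} (hp : ∀ i, Measurable fun ω => p ω i) {y : S → Fin t → ℝ}
    (hy : ∀ i, Measurable fun ω => y ω i) {z : S → Z} (hz : Measurable z) :
    Measurable fun ω => postMean k s (p ω) (y ω) (z ω) :=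
  measurable_dotProduct_inv_gram_add_mulVec hk s hp (fun i => hk.comp (hz.prodMk (hp i))) hy

lemma measurable_postVar (hk : Measurable (Function.uncurry k)) (s : ℝ) {t : ℕ}
    {p : S → Fin t → Z} (hp : ∀ i, Measurable fun ω => p ω i) {z : S → Z} (hz : Measurable z) :
    Measurable fun ω => postVar k s (p ω) (z ω) :=
  (hk.comp (hz.prodMk hz)).sub (measurable_dotProduct_inv_gram_add_mulVec hk s hp
    (fun i => hk.comp (hz.prodMk (hp i))) (fun i => hk.comp (hz.prodMk (hp i))))

lemma measurable_evidenceRatio (hk : Measurable (Function.uncurry k)) (s : ℝ) {t : ℕ}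
    {p : S → Fin t → Z} (hp : ∀ i, Measurable fun ω => p ω i) {e : S → Fin t → ℝ}
    (he : ∀ i, Measurable fun ω => e ω i) :
    Measurable fun ω => evidenceRatio k s (p ω) (e ω) := by
  refine Real.measurable_exp.comp (Measurable.sub (Measurable.const_mul (Measurable.sub ?_ ?_) _)
    (Measurable.const_mul (Real.measurable_log.comp (measurable_det_of_entries fun i j => ?_)) _))
  · simp only [dotProduct]
    exact (Finset.measurable_sum _ fun i _ => (he i).mul (he i)).const_mul _
  · exact measurable_dotProduct_inv_gram_add_mulVec hk s hp he he
  · exact ((hk.comp ((hp i).prodMk (hp j))).const_mul _).const_add _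

end Measurability

/-! ### The likelihood ratio martingale -/

/-- The density of `N(μ, v + s²)` with respect to `N(0, s²)`. -/
noncomputable def gaussianRatio (s μ v e : ℝ) : ℝ :=
  Real.exp (1 / 2 * ((s ^ 2)⁻¹ * e ^ 2 - (e - μ) ^ 2 / (v + s ^ 2)) -
    1 / 2 * Real.log (1 + (s ^ 2)⁻¹ * v))

lemma measurable_gaussianRatio (s : ℝ) :
    Measurable fun q : ℝ × ℝ × ℝ => gaussianRatio s q.1 q.2.1 q.2.2 := by
  unfold gaussianRatio
  fun_prop

lemma gaussianPDFReal_mul_gaussianRatio {s : ℝ} (hs : 0 < s) (μ : ℝ) {v : ℝ} (hv : 0 ≤ v) (e : ℝ) :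
    gaussianPDFReal 0 (s ^ 2).toNNReal e * gaussianRatio s μ v e =
      gaussianPDFReal μ (v + s ^ 2).toNNReal e := by
  have hs2 : 0 < s ^ 2 := by positivity
  have hvs : 0 < v + s ^ 2 := by positivity
  have h1 : 0 < 1 + (s ^ 2)⁻¹ * v := by positivity
  have hlog : Real.exp (-(1 / 2 * Real.log (1 + (s ^ 2)⁻¹ * v))) =
      (√(1 + (s ^ 2)⁻¹ * v))⁻¹ := by
    rw [Real.exp_neg, Real.sqrt_eq_rpow, Real.rpow_def_of_pos h1, mul_comm]
  have hsqrt : √(2 * Real.pi * (v + s ^ 2)) =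
      √(2 * Real.pi * s ^ 2) * √(1 + (s ^ 2)⁻¹ * v) := by
    rw [← Real.sqrt_mul (by positivity)]
    congr 1
    field_simp
    ring
  rw [gaussianPDFReal, gaussianPDFReal, gaussianRatio, Real.coe_toNNReal _ hs2.le,
    Real.coe_toNNReal _ hvs.le, hsqrt, mul_inv, sub_eq_add_neg _ (1 / 2 * Real.log _), Real.exp_add,
    hlog]
  have : Real.exp (-(e - μ) ^ 2 / (2 * (v + s ^ 2))) = Real.exp (-(e - 0) ^ 2 / (2 * s ^ 2)) *
      Real.exp (1 / 2 * ((s ^ 2)⁻¹ * e ^ 2 - (e - μ) ^ 2 / (v + s ^ 2))) := by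
    rw [← Real.exp_add]
    congr 1
    field_simp
    ring
  rw [this]
  ring

lemma lintegral_gaussianRatio {s : ℝ} (hs : 0 < s) (μ : ℝ) {v : ℝ} (hv : 0 ≤ v) :
    ∫⁻ e, ENNReal.ofReal (gaussianRatio s μ v e) ∂gaussianReal 0 (s ^ 2).toNNReal = 1 := by
  have hs2 : 0 < s ^ 2 := by positivity
  have hne : (s ^ 2).toNNReal ≠ 0 := (Real.toNNReal_pos.2 hs2).ne'
  have hne' : (v + s ^ 2).toNNReal ≠ 0 := (Real.toNNReal_pos.2 (by positivity)).ne'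
  have hmeas : Measurable fun e => ENNReal.ofReal (gaussianRatio s μ v e) := by
    unfold gaussianRatio
    fun_prop
  rw [gaussianReal_of_var_ne_zero _ hne,
    lintegral_withDensity_eq_lintegral_mul _ (measurable_gaussianPDF _ _) hmeas,
    ← lintegral_gaussianPDF_eq_one μ hne']
  refine lintegral_congr fun e => ?_
  rw [Pi.mul_apply, gaussianPDF, gaussianPDF, ← ENNReal.ofReal_mul (gaussianPDFReal_nonneg _ _ _),
    gaussianPDFReal_mul_gaussianRatio hs μ hv]

/-- By independence `ε` can be integrated first with `A`, `μ`, `v` frozen, and the inner integral is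
that of a probability density. This is the martingale property. -/
lemma lintegral_mul_gaussianRatio {S : Type*} {m mS : MeasurableSpace S} {P : Measure S}
    [IsProbabilityMeasure P] (hm : m ≤ mS) {s : ℝ} (hs : 0 < s) {A : S → ℝ≥0∞} {μ v ε : S → ℝ}
    (hA : Measurable[m] A) (hμ : Measurable[m] μ) (hv : Measurable[m] v) (hv0 : ∀ ω, 0 ≤ v ω)
    (hε : Measurable ε) (hlaw : P.map ε = gaussianReal 0 (s ^ 2).toNNReal)
    (hindep : Indep m (MeasurableSpace.comap ε inferInstance) P) :
    ∫⁻ ω, A ω * ENNReal.ofReal (gaussianRatio s (μ ω) (v ω) (ε ω)) ∂P = ∫⁻ ω, A ω ∂P := by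
  have hX : Measurable[m] fun ω => (A ω, μ ω, v ω) := hA.prodMk (hμ.prodMk hv)
  have hX' : Measurable fun ω => (A ω, μ ω, v ω) := hX.mono hm le_rfl
  have hind : IndepFun (fun ω => (A ω, μ ω, v ω)) ε P :=
    indep_of_indep_of_le_left hindep hX.comap_le
  have hmap := (indepFun_iff_map_prod_eq_prod_map_map hX'.aemeasurable hε.aemeasurable).1 hind
  have hG : Measurable fun q : (ℝ≥0∞ × ℝ × ℝ) × ℝ =>
      q.1.1 * ENNReal.ofReal (gaussianRatio s q.1.2.1 q.1.2.2 q.2) := by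
    refine (measurable_fst.comp measurable_fst).mul (ENNReal.measurable_ofReal.comp ?_)
    exact (measurable_gaussianRatio s).comp (f := fun q : (ℝ≥0∞ × ℝ × ℝ) × ℝ =>
      (q.1.2.1, q.1.2.2, q.2)) (by fun_prop)
  have h1 : ∫⁻ ω, A ω * ENNReal.ofReal (gaussianRatio s (μ ω) (v ω) (ε ω)) ∂P =
      ∫⁻ q, q.1.1 * ENNReal.ofReal (gaussianRatio s q.1.2.1 q.1.2.2 q.2)
        ∂(P.map fun ω => ((A ω, μ ω, v ω), ε ω)) :=
    (lintegral_map hG (hX'.prodMk hε)).symm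
  rw [h1, hmap, lintegral_prod _ hG.aemeasurable, lintegral_map hG.lintegral_prod_right' hX']
  refine lintegral_congr fun ω => ?_
  dsimp only
  rw [lintegral_const_mul, hlaw, lintegral_gaussianRatio hs _ (hv0 ω), mul_one]
  unfold gaussianRatio
  fun_prop

lemma mul_measure_exists_le_of_submartingale {S : Type*} {mS : MeasurableSpace S} {P : Measure S}
    [IsProbabilityMeasure P] {ℱ : Filtration ℕ mS} {Q : ℕ → S → ℝ} (hQ : Submartingale Q ℱ P)
    (hQ0 : 0 ≤ Q) (hQ1 : ∀ t, ∫ ω, Q t ω ∂P ≤ 1) (c : NNReal) :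
    c * P {ω | ∃ t, (c : ℝ) ≤ Q t ω} ≤ 1 := by
  have hset : {ω | ∃ t, (c : ℝ) ≤ Q t ω} = ⋃ n, {ω | (c : ℝ) ≤
      (Finset.range (n + 1)).sup' Finset.nonempty_range_add_one fun k => Q k ω} := by
    ext ω
    simp only [Set.mem_ofPred_eq, Set.mem_iUnion, Finset.le_sup'_iff, Finset.mem_range]
    exact ⟨fun ⟨t, ht⟩ => ⟨t, t, by omega, ht⟩, fun ⟨_, t, _, ht⟩ => ⟨t, ht⟩⟩
  have hmono : Monotone fun n => {ω | (c : ℝ) ≤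
      (Finset.range (n + 1)).sup' Finset.nonempty_range_add_one fun k => Q k ω} := by
    intro a b hab ω
    simp only [Set.mem_ofPred_eq, Finset.le_sup'_iff, Finset.mem_range]
    exact fun ⟨t, h1, h2⟩ => ⟨t, by omega, h2⟩
  -- The maximal inequality has a finite horizon; continuity from below extends it to all times.
  rw [hset, hmono.measure_iUnion, ENNReal.mul_iSup]
  refine iSup_le fun n => (maximal_ineq hQ hQ0 n).trans ?_
  rw [← ENNReal.ofReal_one]
  refine ENNReal.ofReal_le_ofReal ((setIntegral_le_integral (hQ.integrable n) ?_).trans (hQ1 n))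
  exact Filter.Eventually.of_forall fun ω => hQ0 n ω

section LikelihoodRatio

variable {Z E : Type*} [NormedAddCommGroup E] [InnerProductSpace ℝ E] {φ : Z → E}
  {k : Z → Z → ℝ}

/-- Chain rule for likelihoods: the new factor compares the predictive law of the next noise with
its true law. -/
lemma evidenceRatio_succ (hk : ∀ z z', k z z' = ⟪φ z, φ z'⟫) {s : ℝ} (hs : 0 < s)
    (p : ℕ → Z) (e : ℕ → ℝ) (t : ℕ) :
    evidenceRatio k s (fun i : Fin (t + 1) => p i) (fun i => e i) =
      evidenceRatio k s (fun i : Fin t => p i) (fun i => e i) *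
        gaussianRatio s (postMean k s (fun i : Fin t => p i) (fun i => e i) (p t))
          (postVar k s (fun i : Fin t => p i) (p t)) (e t) := by
  have hv := postVar_nonneg hk hs (fun i : Fin t => p i) (p t)
  have h1 : 0 < 1 + (s ^ 2)⁻¹ * postVar k s (fun i : Fin t => p i) (p t) := by positivity
  rw [evidenceRatio, evidenceRatio, gaussianRatio, ← Real.exp_add, noiseEnergy_succ hk hs,
    det_one_add_gram_succ hk hs,
    Real.log_mul (det_one_add_gram_pos hk hs _).ne' h1.ne']
  congr 1
  ring

variable [MeasurableSpace Z] {S : Type*} {mS : MeasurableSpace S} {P : Measure S}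
  [IsProbabilityMeasure P] {ℱ : Filtration ℕ mS} {z : ℕ → S → Z} {ε : ℕ → S → ℝ} {s : ℝ}

lemma measurable_evidenceRatio_process (hkm : Measurable (Function.uncurry k))
    (hz : ∀ t, Measurable[ℱ t] (z t)) (hε : ∀ t, Measurable[ℱ (t + 1)] (ε t)) (s : ℝ) (t : ℕ) :
    Measurable[ℱ t] fun ω => evidenceRatio k s (fun i : Fin t => z i ω) (fun i => ε i ω) :=
  measurable_evidenceRatio hkm s (fun i => (hz i).mono (ℱ.mono i.2.le) le_rfl)
    (fun i => (hε i).mono (ℱ.mono i.2) le_rfl)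

lemma setLIntegral_evidenceRatio_succ (hk : ∀ z z', k z z' = ⟪φ z, φ z'⟫)
    (hkm : Measurable (Function.uncurry k)) (hs : 0 < s)
    (hz : ∀ t, Measurable[ℱ t] (z t)) (hε : ∀ t, Measurable[ℱ (t + 1)] (ε t))
    (hlaw : ∀ t, P.map (ε t) = gaussianReal 0 (s ^ 2).toNNReal)
    (hfresh : ∀ t, Indep (ℱ t) (MeasurableSpace.comap (ε t) inferInstance) P)
    (t : ℕ) {A : Set S} (hA : MeasurableSet[ℱ t] A) :
    ∫⁻ ω in A, ENNReal.ofReal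
        (evidenceRatio k s (fun i : Fin (t + 1) => z i ω) (fun i => ε i ω)) ∂P =
      ∫⁻ ω in A, ENNReal.ofReal
        (evidenceRatio k s (fun i : Fin t => z i ω) (fun i => ε i ω)) ∂P := by
  have hA' := ℱ.le t _ hA
  have hzi (i : Fin t) : Measurable[ℱ t] (z i) := (hz i).mono (ℱ.mono i.2.le) le_rfl
  have hεi (i : Fin t) : Measurable[ℱ t] (ε i) := (hε i).mono (ℱ.mono i.2) le_rfl
  rw [← lintegral_indicator hA', ← lintegral_indicator hA']
  have hQ : Measurable[ℱ t] (A.indicator fun ω => ENNReal.ofReal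
      (evidenceRatio k s (fun i : Fin t => z i ω) (fun i => ε i ω))) :=
    (ENNReal.measurable_ofReal.comp
      (measurable_evidenceRatio_process hkm hz hε s t)).indicator hA
  rw [← lintegral_mul_gaussianRatio (ℱ.le t) hs hQ
    (measurable_postMean hkm s hzi hεi (hz t))
    (measurable_postVar hkm s hzi (hz t)) (fun ω => postVar_nonneg hk hs _ _)
    ((hε t).mono (ℱ.le _) le_rfl) (hlaw t) (hfresh t)]
  refine lintegral_congr fun ω => ?_
  by_cases hω : ω ∈ A
  · rw [Set.indicator_of_mem hω, Set.indicator_of_mem hω,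
      evidenceRatio_succ hk hs (fun i => z i ω) (fun i => ε i ω),
      ENNReal.ofReal_mul (evidenceRatio_nonneg _ _ _ _)]
  · rw [Set.indicator_of_notMem hω, Set.indicator_of_notMem hω, zero_mul]

lemma lintegral_evidenceRatio (hk : ∀ z z', k z z' = ⟪φ z, φ z'⟫)
    (hkm : Measurable (Function.uncurry k)) (hs : 0 < s)
    (hz : ∀ t, Measurable[ℱ t] (z t)) (hε : ∀ t, Measurable[ℱ (t + 1)] (ε t))
    (hlaw : ∀ t, P.map (ε t) = gaussianReal 0 (s ^ 2).toNNReal)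
    (hfresh : ∀ t, Indep (ℱ t) (MeasurableSpace.comap (ε t) inferInstance) P) (t : ℕ) :
    ∫⁻ ω, ENNReal.ofReal (evidenceRatio k s (fun i : Fin t => z i ω) (fun i => ε i ω)) ∂P = 1 := by
  induction t with
  | zero => simp [evidenceRatio, noiseEnergy]
  | succ t ih =>
    have := setLIntegral_evidenceRatio_succ hk hkm hs hz hε hlaw hfresh t MeasurableSet.univ
    rwa [Measure.restrict_univ, ih] at this

lemma submartingale_evidenceRatio (hk : ∀ z z', k z z' = ⟪φ z, φ z'⟫)
    (hkm : Measurable (Function.uncurry k)) (hs : 0 < s)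
    (hz : ∀ t, Measurable[ℱ t] (z t)) (hε : ∀ t, Measurable[ℱ (t + 1)] (ε t))
    (hlaw : ∀ t, P.map (ε t) = gaussianReal 0 (s ^ 2).toNNReal)
    (hfresh : ∀ t, Indep (ℱ t) (MeasurableSpace.comap (ε t) inferInstance) P) :
    Submartingale (fun t ω => evidenceRatio k s (fun i : Fin t => z i ω) (fun i => ε i ω)) ℱ P := by
  have hmeas := measurable_evidenceRatio_process hkm hz hε s
  have hmeas' (t : ℕ) : AEStronglyMeasurable
      (fun ω => evidenceRatio k s (fun i : Fin t => z i ω) (fun i => ε i ω)) P :=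
    ((hmeas t).mono (ℱ.le t) le_rfl).aestronglyMeasurable
  have hnonneg (t : ℕ) (μ : Measure S) :
      0 ≤ᵐ[μ] fun ω => evidenceRatio k s (fun i : Fin t => z i ω) (fun i => ε i ω) :=
    Filter.Eventually.of_forall fun ω => evidenceRatio_nonneg _ _ _ _
  refine submartingale_of_setIntegral_le_succ (fun t => (hmeas t).stronglyMeasurable)
    (fun t => ⟨hmeas' t, ?_⟩) fun t A hA => ?_
  · rw [hasFiniteIntegral_iff_ofReal (hnonneg t P),
      lintegral_evidenceRatio hk hkm hs hz hε hlaw hfresh]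
    exact ENNReal.one_lt_top
  · rw [integral_eq_lintegral_of_nonneg_ae (hnonneg t _) (hmeas' t).restrict,
      integral_eq_lintegral_of_nonneg_ae (hnonneg (t + 1) _) (hmeas' (t + 1)).restrict,
      setLIntegral_evidenceRatio_succ hk hkm hs hz hε hlaw hfresh t hA]

/-- Uniformly in time, the likelihood ratio stays below `c` up to probability `1 / c`. -/
lemma mul_measure_exists_le_evidenceRatio (hk : ∀ z z', k z z' = ⟪φ z, φ z'⟫)
    (hkm : Measurable (Function.uncurry k)) (hs : 0 < s)
    (hz : ∀ t, Measurable[ℱ t] (z t)) (hε : ∀ t, Measurable[ℱ (t + 1)] (ε t))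
    (hlaw : ∀ t, P.map (ε t) = gaussianReal 0 (s ^ 2).toNNReal)
    (hfresh : ∀ t, Indep (ℱ t) (MeasurableSpace.comap (ε t) inferInstance) P) (c : NNReal) :
    c * P {ω | ∃ t : ℕ, (c : ℝ) ≤ evidenceRatio k s (fun i : Fin t => z i ω) (fun i => ε i ω)}
      ≤ 1 := by
  have hsub := submartingale_evidenceRatio hk hkm hs hz hε hlaw hfresh
  refine mul_measure_exists_le_of_submartingale hsub (fun t ω => evidenceRatio_nonneg _ _ _ _)
    (fun t => ?_) c
  rw [integral_eq_lintegral_of_nonneg_ae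
    (Filter.Eventually.of_forall fun ω => evidenceRatio_nonneg _ _ _ _) (hsub.integrable t).1,
    lintegral_evidenceRatio hk hkm hs hz hε hlaw hfresh, ENNReal.toReal_one]

end LikelihoodRatio

/-! ### Confidence bounds in a reproducing kernel Hilbert space -/

section KernelSpace

variable {Z H : Type*} [NormedAddCommGroup H] [InnerProductSpace ℝ H] [CompleteSpace H]
  [RKHS ℝ H Z ℝ] {k : Z → Z → ℝ}

lemma IsRKHSOf.eq_inner (hH : IsRKHSOf H k) (z z' : Z) :
    k z z' = ⟪RKHS.kerFun H z 1, RKHS.kerFun H z' 1⟫ := by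
  rw [← hH, RKHS.kerFun_inner, RKHS.kerFun_apply]
  simp

lemma rkhs_apply_eq_inner (g : H) (z : Z) : g z = ⟪RKHS.kerFun H z 1, g⟫ := by
  rw [RKHS.kerFun_inner]
  simp

/-- The functions in the reproducing kernel Hilbert space of a measurable kernel are measurable. -/
lemma IsRKHSOf.measurable_coe [MeasurableSpace Z] (hH : IsRKHSOf H k)
    (hk : Measurable (Function.uncurry k)) (g : H) : Measurable g := by
  have hspan : ∀ h ∈ Submodule.span ℝ {RKHS.kerFun H z v | (z : Z) (v : ℝ)}, Measurable h := by
    intro h hh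
    induction hh using Submodule.span_induction with
    | mem h hh =>
      obtain ⟨z, v, rfl⟩ := hh
      have : ⇑(RKHS.kerFun H z v) = fun x => v * k x z := by
        ext x
        rw [RKHS.kerFun_apply, ← hH, ← smul_eq_mul, ← map_smul, smul_eq_mul, mul_one]
      rw [this]
      exact (hk.comp (measurable_id.prodMk measurable_const)).const_mul v
    | zero =>
      rw [RKHS.coe_zero]
      exact measurable_const
    | add a b _ _ ha hb =>
      rw [RKHS.coe_add]
      exact ha.add hb
    | smul c a _ ha =>
      rw [RKHS.coe_smul]
      exact ha.const_smul c
  -- Kernel sections span a dense subspace and evaluations are continuous, so `g` is a pointwise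
  -- limit of measurable functions.
  have hg : g ∈ closure (Submodule.span ℝ {RKHS.kerFun H z v | (z : Z) (v : ℝ)} : Set H) := by
    rw [← Submodule.topologicalClosure_coe, RKHS.kerFun_dense]
    trivial
  obtain ⟨u, hu, hlim⟩ := mem_closure_iff_seq_limit.1 hg
  refine measurable_of_tendsto_metrizable (fun n => hspan (u n) (hu n)) ?_
  exact tendsto_pi_nhds.2 fun z => ((RKHS.continuous_eval z).tendsto g).comp hlim

/-- As long as the likelihood ratio stays below `M / δ`, the function lies in its credible
interval. -/
lemma mem_Icc_lowerCI_upperCI (hH : IsRKHSOf H k) (hk1 : ∀ z, k z z ≤ 1) {s : ℝ} (hs : 0 < s)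
    {g : H} {B : ℝ} (hB : ‖g‖ ≤ B) {M : ℕ} {δ : ℝ} (hMδ : 0 < M / δ) (p : ℕ → Z) (e : ℕ → ℝ) (t : ℕ)
    (h : evidenceRatio k s (fun i : Fin t => p i) (fun i => e i) < M / δ) (z : Z) :
    g z ∈ Set.Icc
      (lowerCI k s B M δ (fun i : Fin t => p i) (fun i => g (p i) + e i) z)
      (upperCI k s B M δ (fun i : Fin t => p i) (fun i => g (p i) + e i) z) := by
  have hbias := abs_inner_sub_postMean_le hH.eq_inner hs (fun i : Fin t => p i) g z
  simp only [← rkhs_apply_eq_inner] at hbias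
  have hnoise := postMean_sq_le hH.eq_inner hs (fun i : Fin t => p i) (fun i => e i) z
  have hvar := postVar_nonneg hH.eq_inner hs (fun i : Fin t => p i) z
  have hκ := half_log_det_le_maxInfoGain_succ hH.eq_inner hk1 hs p t
  have henergy : noiseEnergy k s (fun i : Fin t => p i) (fun i => e i) ≤
      2 * (maxInfoGain k s (t + 1) + Real.log (M / δ)) := by
    -- The logarithm of the bound on the ratio, with the log-determinant absorbed by `hκ`.
    have := (Real.lt_log_iff_exp_lt hMδ).2 h
    linarith
  have hnoise' : |postMean k s (fun i : Fin t => p i) (fun i => e i) z| ≤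
      √(2 * (maxInfoGain k s (t + 1) + Real.log (M / δ))) *
        √(postVar k s (fun i : Fin t => p i) z) := by
    rw [← Real.sqrt_mul' _ hvar]
    refine Real.abs_le_sqrt (hnoise.trans ?_)
    rw [mul_comm]
    exact mul_le_mul_of_nonneg_right henergy hvar
  have hB' := mul_le_mul_of_nonneg_right hB (Real.sqrt_nonneg (postVar k s (fun i : Fin t => p i) z))
  rw [lowerCI, upperCI, betaSqrt, postMean_add, add_mul]
  rw [abs_le] at hbias hnoise'
  constructor <;> linarith [hbias.1, hbias.2, hnoise'.1, hnoise'.2]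

end KernelSpace

/-- A union bound over finitely many events, each of probability at least `1 - δ / M`. -/
lemma ofReal_one_sub_le_measure {S : Type*} {mS : MeasurableSpace S} {P : Measure S}
    [IsProbabilityMeasure P] {M : ℕ} (hM : 1 ≤ M) {δ : ℝ} (hδ : 0 < δ) {bad : Fin M → Set S}
    (hmeas : ∀ m, MeasurableSet (bad m))
    (h : ∀ m, ((M / δ).toNNReal : ℝ≥0∞) * P (bad m) ≤ 1) :
    ENNReal.ofReal (1 - δ) ≤ P (⋃ m, bad m)ᶜ := by
  have hM0 : (0 : ℝ) < M := by exact_mod_cast hM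
  have hbad (m : Fin M) : P (bad m) ≤ ENNReal.ofReal (δ / M) := by
    have h1 : ((M / δ).toNNReal : ℝ≥0∞) = ENNReal.ofReal (M / δ) := rfl
    have h2 : ENNReal.ofReal (δ / M) = (ENNReal.ofReal (M / δ))⁻¹ := by
      rw [← ENNReal.ofReal_inv_of_pos (by positivity), inv_div]
    rw [h2, ← one_div, ENNReal.le_div_iff_mul_le (Or.inr one_ne_zero) (Or.inr ENNReal.one_ne_top),
      mul_comm, ← h1]
    exact h m
  have hunion : P (⋃ m, bad m) ≤ ENNReal.ofReal δ :=
    calc P (⋃ m, bad m) ≤ ∑ m, P (bad m) := measure_iUnion_fintype_le P bad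
      _ ≤ ∑ _m : Fin M, ENNReal.ofReal (δ / M) := Finset.sum_le_sum fun m _ => hbad m
      _ = ENNReal.ofReal δ := by
        rw [Finset.sum_const, Finset.card_univ, Fintype.card_fin, nsmul_eq_mul,
          ← ENNReal.ofReal_natCast, ← ENNReal.ofReal_mul hM0.le]
        congr 1
        field_simp
  rw [prob_compl_eq_one_sub (MeasurableSet.iUnion hmeas), ENNReal.ofReal_sub _ hδ.le,
    ENNReal.ofReal_one]
  exact tsub_le_tsub_left hunion 1

end ParetoBO

/-! ### The confidence event and the main bound -/

theorem theorem1
    -- design variables, environmental variables, number of objectives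
    {d₁ d₂ M : ℕ} (hM : 1 ≤ M)
    (X : Set (EuclideanSpace ℝ (Fin d₁))) (hXc : IsCompact X) (hXconv : Convex ℝ X)
    (W : Set (EuclideanSpace ℝ (Fin d₂))) (hWc : IsCompact W) (hWconv : Convex ℝ W)
    -- regularity assumption
    (k : Fin M → (X × W) → (X × W) → ℝ)
    (hk_meas : ∀ m, Measurable (Function.uncurry (k m)))
    (hk_le : ∀ m z, k m z z ≤ 1)
    (H : Fin M → Type*) [∀ m, NormedAddCommGroup (H m)] [∀ m, InnerProductSpace ℝ (H m)]
    [∀ m, CompleteSpace (H m)] [∀ m, RKHS ℝ (H m) (X × W) ℝ]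
    (hH : ∀ m, IsRKHSOf (H m) (k m))
    (f : ∀ m, H m) (B : Fin M → ℝ) (hB : ∀ m, ‖f m‖ ≤ B m)
    -- Gaussian noises, independent over iterations and objectives
    {S : Type*} [MeasurableSpace S] (P : Measure S) [IsProbabilityMeasure P]
    (ς : Fin M → ℝ) (hς : ∀ m, 0 < ς m)
    (noise : ℕ → Fin M → S → ℝ)
    (hnoise_law : ∀ i m, P.map (noise i m) = gaussianReal 0 (Real.toNNReal (ς m ^ 2)))
    (hnoise_indep : iIndepFun (fun q : ℕ × Fin M => noise q.1 q.2) P)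
    -- adaptive queries: `z t` is the query number `t + 1`, chosen from the information `ℱ t`
    -- available after `t` observations, of which the next noises are independent
    (ℱ : Filtration ℕ (inferInstance : MeasurableSpace S))
    (z : ℕ → S → X × W) (hz : ∀ t, Measurable[ℱ t] (z t))
    (hnoise_adapted : ∀ t m, Measurable[ℱ (t + 1)] (noise t m))
    (hnoise_fresh : ∀ t, Indep (ℱ t)
      (MeasurableSpace.comap (fun ω m => noise t m ω) MeasurableSpace.pi) P)
    -- risk measures
    (ρ : Fin M → (W → ℝ) → ℝ)
    {δ : ℝ} (hδ : δ ∈ Set.Ioo (0 : ℝ) 1)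
    -- bounds for the risk measures after `t` observations, and the credible-interval condition
    (lcb ucb : ℕ → S → X → Fin M → ℝ)
    (hCI : ∀ (t : ℕ) (ω : S) (x : X) (m : Fin M),
      ∀ g ∈ credibleFunctions (k m) (ς m) (B m) M δ (fun i : Fin t => z i ω)
          (fun i : Fin t => f m (z i ω) + noise i m ω) x,
        lcb t ω x m ≤ ρ m g ∧ ρ m g ≤ ucb t ω x m) :
    ∃ A : Set S, MeasurableSet A ∧ ENNReal.ofReal (1 - δ) ≤ P A ∧ ∀ ω ∈ A,
      (∀ (t : ℕ) (x : X), IsNextDesign (lcb t ω) (ucb t ω) x →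
        inferenceDiscrepancy (fun x m => ρ m fun w => f m (x, w)) (estimatedSet (lcb t ω)) ≤
          acquisition (lcb t ω) (ucb t ω) x) ∧
      (∀ ε : ℝ, 0 < ε → ∀ (T : ℕ) (x : X), IsNextDesign (lcb T ω) (ucb T ω) x →
        acquisition (lcb T ω) (ucb T ω) x ≤ ENNReal.ofReal ε →
        inferenceDiscrepancy (fun x m => ρ m fun w => f m (x, w)) (estimatedSet (lcb T ω)) ≤
          ENNReal.ofReal ε) := by
  have hM0 : (0 : ℝ) < M := by exact_mod_cast hM
  have hMδ : 0 < M / δ := div_pos hM0 hδ.1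
  have hfresh (m : Fin M) (t : ℕ) :
      Indep (ℱ t) (MeasurableSpace.comap (noise t m) inferInstance) P := by
    refine indep_of_indep_of_le_right (hnoise_fresh t) ?_
    rw [show noise t m = (fun v : Fin M → ℝ => v m) ∘ (fun ω m => noise t m ω) from rfl,
      ← MeasurableSpace.comap_comp]
    exact MeasurableSpace.comap_mono (measurable_pi_apply m).comap_le
  have hmeas (m : Fin M) (t : ℕ) : Measurable fun ω =>
      evidenceRatio (k m) (ς m) (fun i : Fin t => z i ω) (fun i => noise i m ω) :=
    (measurable_evidenceRatio_process (ε := fun t => noise t m) (hk_meas m) hz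
      (fun t => hnoise_adapted t m) (ς m) t).mono (ℱ.le t) le_rfl
  set bad : Fin M → Set S := fun m => {ω | ∃ t : ℕ, ((M / δ).toNNReal : ℝ) ≤
    evidenceRatio (k m) (ς m) (fun i : Fin t => z i ω) (fun i => noise i m ω)} with hbad
  have hbad_meas (m : Fin M) : MeasurableSet (bad m) := by
    have : bad m = ⋃ t : ℕ, {ω | ((M / δ).toNNReal : ℝ) ≤
        evidenceRatio (k m) (ς m) (fun i : Fin t => z i ω) (fun i => noise i m ω)} := by
      ext ω
      simp [hbad]
    rw [this]
    exact MeasurableSet.iUnion fun t => measurableSet_le measurable_const (hmeas m t)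
  have hle (ω : S) (hω : ω ∈ (⋃ m, bad m)ᶜ) (t : ℕ) (x : X)
      (hx : IsNextDesign (lcb t ω) (ucb t ω) x) :
      inferenceDiscrepancy (fun x m => ρ m fun w => f m (x, w)) (estimatedSet (lcb t ω)) ≤
        acquisition (lcb t ω) (ucb t ω) x := by
    -- Off the bad events `f m (x, ·)` is itself a credible function, so the condition on the bounds
    -- gives LCB ≤ F ≤ UCB for all `t` and `x` at once.
    have hcred (x : X) (m : Fin M) := by
      refine hCI t ω x m (fun w => f m (x, w))
        ⟨((hH m).measurable_coe (hk_meas m) (f m)).comp measurable_prodMk_left, fun w => ?_⟩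
      refine mem_Icc_lowerCI_upperCI (hH m) (hk_le m) (hς m) (hB m) hMδ (fun i => z i ω)
        (fun i => noise i m ω) t ?_ (x, w)
      have hm : ω ∉ bad m := fun h => hω (Set.mem_iUnion.2 ⟨m, h⟩)
      by_contra! hge
      exact hm ⟨t, by rwa [Real.coe_toNNReal _ hMδ.le]⟩
    exact inferenceDiscrepancy_le_of_acquisition_le (fun x m => (hcred x m).1)
      (fun x m => (hcred x m).2) hx
  refine ⟨(⋃ m, bad m)ᶜ, (MeasurableSet.iUnion hbad_meas).compl,
    ofReal_one_sub_le_measure hM hδ.1 hbad_meas fun m => ?_, fun ω hω =>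
    ⟨hle ω hω, fun ε _ T x hx hT => (hle ω hω T x hx).trans hT⟩⟩
  exact mul_measure_exists_le_evidenceRatio (ε := fun t => noise t m) (hH m).eq_inner (hk_meas m)
    (hς m) hz (fun t => hnoise_adapted t m) (fun t => hnoise_law t m) (hfresh m) _
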